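/- Let $p,q,n$ be positive integers, let $a=(-1)^{p+q-1}$ and $b=\pm1$, with $p\neq1$ when $b=1$, and $q\neq1$ when $a=1$. Then the following series (in general only conditionally convergent) converges and \[\sum_{k=1}^\infty (a^n)^{k}\, \mathcal{H}_k^{(p)}(b)\sum_{j=1}^{n}\frac{a^{j-1}}{(2nk+2j-1)^q}= 2^{-q-1}\left(1-(-1)^{p}\right)\Phi\left(a,q,\tfrac12\right)\Phi(b,p,1)\] \[-a^{n-1} (-2)^{-q} n^{p}\sum_{k=0}^{\lfloor p/2\rfloor}\binom{p+q-2k-1}{q-1}n^{-2k}\,\Phi(a^nb,2k,1)\,\Phi\left(a,p+q-2k,\tfrac{1}{2}\right)\] \[-\frac12\, a\, (-2n)^{-q}\sum_{j=1}^{n}\sum_{k=1}^{q}\binom{p+q-k-1}{p-1}a^j(-1)^{k}\,\Theta(a^nb,k,2j-1,2n)\,\Phi\left(b,p+q-k,\frac{2n-2j+1}{2n}\right).\] Here $\mathcal{H}_k^{(p)}(b)=\sum_{m=1}^{k}\frac{b^{m-1}}{m^p}$. For $c=\pm1$, an integer $r\ge 1$ with $(c,r)\neq(1,1)$, and $\alpha>0$,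 $\Phi(c,r,\alpha)=\sum_{m=0}^\infty \frac{c^m}{(m+\alpha)^r}$ is the Lerch transcendent; for $r=0$ it is understood by analytic continuation in $r$, so that $\Phi(1,0,1)=\zeta(0)=-\tfrac12$ and $\Phi(-1,0,1)=\eta(0)=\tfrac12$, where $\zeta$ is the Riemann zeta function and $\eta$ the Dirichlet eta function. For $0<s<r$ and an integer $k\ge1$, $\Theta(c,k,s,r)=\Phi\left(c,k,\tfrac{s}{r}\right)+c(-1)^{k}\,\Phi\left(c,k,\tfrac{r-s}{r}\right)$ if $(c,k)\neq(1,1)$, and $\Theta(1,1,s,r)=\pi\cot\left(\tfrac{\pi s}{r}\right)$, the Cauchy principal value of $\int_0^\infty \frac{r\,x^{s-1}}{1-x^r}\,dx$. -/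

import Mathlib

open Filter Topology

/-- The Lerch transcendent `Φ(c, q, α)` for `c = ±1`, a natural order `q` and a real `α` that is
not a non-positive integer. For `q ≥ 1` it is the sum of the (possibly only conditionally
convergent) series `∑_{m ≥ 0} c ^ m / (m + α) ^ q`, i.e. the limit of its partial sums. For `q = 0`
the series diverges and `Φ` is its analytic continuation in the order to `0`: the value
`ζ(0, α) = 1 / 2 - α` of the Hurwitz zeta function if `c = 1`, and `1 / (1 - c)` otherwise.
(The pair `c = 1`, `q = 1` is outside the domain.) -/
noncomputable def lerchPhi (c : ℝ) (q : ℕ) (α : ℝ) : ℝ :=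
  if q = 0 then
    if c = 1 then 1 / 2 - α else 1 / (1 - c)
  else
    limUnder atTop (fun N : ℕ => ∑ m ∈ Finset.range N, c ^ m / ((m : ℝ) + α) ^ q)

/-- `Φ(1, 0, 1) = ζ(0)`. -/
theorem lerchPhi_one_zero_one : ((lerchPhi 1 0 1 : ℝ) : ℂ) = riemannZeta 0 := by
  rw [riemannZeta_zero]
  norm_num [lerchPhi]

/-- `Φ(-1, 0, 1) = η(0) = (1 - 2 ^ (1 - 0)) ζ(0)`. -/
theorem lerchPhi_neg_one_zero_one :
    ((lerchPhi (-1) 0 1 : ℝ) : ℂ) = (1 - 2 ^ (1 - 0 : ℂ)) * riemannZeta 0 := by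
  rw [riemannZeta_zero]
  norm_num [lerchPhi]

/-- `Θ(c, q, s, r) = Φ(c, q, s / r) + c (-1) ^ q Φ(c, q, (r - s) / r)` for `0 < s < r`. For
`c = q = 1`, where both terms are undefined, it is the Cauchy principal value of
`∫₀^∞ r x ^ (s - 1) / (1 - x ^ r) dx`, which is `π cot (π s / r)`. -/
noncomputable def lerchTheta (c : ℝ) (q : ℕ) (s r : ℝ) : ℝ :=
  if c = 1 ∧ q = 1 then Real.pi * Real.cot (Real.pi * s / r)
  else lerchPhi c q (s / r) + c * (-1) ^ q * lerchPhi c q ((r - s) / r)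

/-- `H_k^{(p)}(b) = ∑_{m = 1}^k b ^ (m - 1) / m ^ p`. -/
noncomputable def genHarmonic (p : ℕ) (b : ℝ) (k : ℕ) : ℝ :=
  ∑ m ∈ Finset.Icc 1 k, b ^ (m - 1) / (m : ℝ) ^ p

/-! Put c = aⁿb and let y_r = (r + 1/2)/n with r ≥ 0. The identity comes from evaluating the double
series of aʳcᵐ / (mᵖ(y_r - m)ᑫ), over the nodes y_r and the nonzero integers m, in both orders.

Integers first: partial fractions leave powers of 1/y_r times symmetric sums of cᵐ/mⁱ, where odd i
cancel, and of cᵐ/(y_r - m)ᵏ, which are ±Θ by the cotangent expansion and quasi-periodicity in y_r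
(`tendsto_bilateralValue`). Summing over the nodes then produces the two finite sums of the formula
(`tendsto_sum_bilateralValue`).

Nodes first: translation and reflection by m preserve the half-integer grid, so the inner sum
involves only g(m), the sum of aʳ/y_rᑫ over y_r < m, and its limit γ. The sign of a makes m and -m
together contribute 2(-1)ᵖ(γ - g(m)) + (1 - (-1)ᵖ)γ. Summation by parts (`sum_genHarmonic_mul_eq`)
identifies the sum of bᵐ⁻¹(γ - g(m))/mᵖ with (2n)ᑫ times the required series.

Convergence may be conditional, so the exchange needs an estimate
(`tendsto_sum_bilateral_sub_sum_oddNodeSum`): as γ - g(m) = O(1/m), truncating at nN nodes costs at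
most a multiple of the sum of 1/(m(|m - N| + 1)), which is O(N^(-1/2)). -/

/-! ### Partial fractions -/

/-- Partial fraction decomposition of `x⁻ᵖ z⁻ᑫ` in terms of powers of `x⁻¹`, `z⁻¹` and
`(x + z)⁻¹`, written as an identity for elements with `X Z = (X + Z) Y`. -/
theorem pow_mul_pow_eq_sum_partialFraction {R : Type*} [CommRing R] {X Z Y : R}
    (h : X * Z = (X + Z) * Y) (p q : ℕ) (hpq : 1 ≤ p + q) :
    X ^ p * Z ^ q =
      ∑ i ∈ Finset.range p, ((q + i - 1).choose i : R) * X ^ (p - i) * Y ^ (q + i) +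
      ∑ k ∈ Finset.range q, ((p + k - 1).choose k : R) * Z ^ (q - k) * Y ^ (p + k) := by
  -- With the other exponent 0, truncated subtraction makes the coefficient 1 at k = 0 and `(k -
  -- 1).choose k = 0` afterwards.
  have base (X Y : R) (q : ℕ) (hq : 1 ≤ q) :
      ∑ k ∈ Finset.range q, ((0 + k - 1).choose k : R) * X ^ (q - k) * Y ^ (0 + k) = X ^ q := by
    rw [Finset.sum_eq_single_of_mem 0 (Finset.mem_range.mpr hq)]
    · simp
    · intro k _ hk
      rw [Nat.choose_eq_zero_of_lt (by omega)]
      simp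
  have pascal (X Y : R) (p q : ℕ) :
      ∑ i ∈ Finset.range (p + 1), ((q + 1 + i - 1).choose i : R) * X ^ (p + 1 - i) *
        Y ^ (q + 1 + i) =
      Y * (∑ i ∈ Finset.range p, ((q + 1 + i - 1).choose i : R) * X ^ (p - i) * Y ^ (q + 1 + i) +
        ∑ i ∈ Finset.range (p + 1), ((q + i - 1).choose i : R) * X ^ (p + 1 - i) * Y ^ (q + i)) := by
    rw [Finset.sum_range_succ' _ p, Finset.sum_range_succ' _ p, mul_add, mul_add, ← add_assoc,
      Finset.mul_sum, Finset.mul_sum, ← Finset.sum_add_distrib]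
    congr 1
    · refine Finset.sum_congr rfl fun i _ => ?_
      rw [show q + 1 + (i + 1) - 1 = q + i + 1 by omega, Nat.choose_succ_succ,
        show q + 1 + i - 1 = q + i by omega, show q + (i + 1) - 1 = q + i by omega,
        show p + 1 - (i + 1) = p - i by omega]
      push_cast
      ring
    · simp
      ring
  induction p generalizing q with
  | zero => rw [base Z Y q (by omega)]; simp
  | succ p ihp =>
    induction q with
    | zero => rw [base X Y (p + 1) (by omega)]; simp
    | succ q ihq =>
      have h1 := ihp (q + 1) (by omega)
      have h2 := ihq (by omega)
      rw [pascal X Y p q, pascal Z Y q p]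
      -- Trading one factor XZ for (X + Z)Y lowers either exponent by one; `pascal` is the same
      -- recursion on the coefficients.
      have : X ^ (p + 1) * Z ^ (q + 1) = Y * (X ^ p * Z ^ (q + 1) + X ^ (p + 1) * Z ^ q) := by
        linear_combination X ^ p * Z ^ q * h
      rw [this, h1, h2]
      ring

theorem inv_pow_mul_inv_pow_eq_sum_partialFraction {x z y : ℝ} (hx : x ≠ 0) (hz : z ≠ 0)
    (hy : y ≠ 0) (h : x + z = y) (p q : ℕ) (hpq : 1 ≤ p + q) :
    x⁻¹ ^ p * z⁻¹ ^ q =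
      ∑ i ∈ Finset.range p, ((q + i - 1).choose i : ℝ) * x⁻¹ ^ (p - i) * y⁻¹ ^ (q + i) +
      ∑ k ∈ Finset.range q, ((p + k - 1).choose k : ℝ) * z⁻¹ ^ (q - k) * y⁻¹ ^ (p + k) := by
  refine pow_mul_pow_eq_sum_partialFraction ?_ p q hpq
  field_simp
  linarith

/-- A hockey-stick sum: it collects the y⁻⁽ᵖ⁺ᑫ⁾ terms created by omitting m = 0 from the bilateral
sums. -/
theorem sum_range_choose_add_sub_one (p q : ℕ) (hp : 1 ≤ p) (hq : 1 ≤ q) :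
    ∑ k ∈ Finset.range q, (p + k - 1).choose k = (p + q - 1).choose (q - 1) := by
  obtain ⟨q, rfl⟩ : ∃ r, q = r + 1 := ⟨q - 1, by omega⟩
  obtain ⟨p, rfl⟩ : ∃ r, p = r + 1 := ⟨p - 1, by omega⟩
  induction q with
  | zero => simp
  | succ q ih =>
    rw [Finset.sum_range_succ, ih (by omega), show p + 1 + (q + 1 + 1) - 1 = (p + 1 + q) + 1 by omega,
      show q + 1 + 1 - 1 = q + 1 by omega, Nat.choose_succ_succ]
    congr 2

/-! ### Convergence and remainders of the Lerch series -/

theorem antitone_inv_nat_add_pow {α : ℝ} (hα : 0 < α) (q : ℕ) :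
    Antitone fun m : ℕ => (((m : ℝ) + α) ^ q)⁻¹ := by
  intro i j hij
  have : (i : ℝ) ≤ j := by exact_mod_cast hij
  have hi : (0 : ℝ) ≤ i := i.cast_nonneg
  dsimp only
  gcongr

theorem tendsto_inv_nat_add_pow (α : ℝ) {q : ℕ} (hq : q ≠ 0) :
    Tendsto (fun m : ℕ => (((m : ℝ) + α) ^ q)⁻¹) atTop (𝓝 0) :=
  tendsto_inv_atTop_zero.comp <| (tendsto_pow_atTop hq).comp <|
    tendsto_atTop_add_const_right _ _ tendsto_natCast_atTop_atTop

/-- The Lerch series converges in its domain, conditionally if `q = 1`. -/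
theorem tendsto_lerchPhi {c α : ℝ} {q : ℕ} (hc : c = 1 ∨ c = -1) (hq : 1 ≤ q) (hα : 0 < α)
    (hcq : c = 1 → q ≠ 1) :
    Tendsto (fun N : ℕ => ∑ m ∈ Finset.range N, c ^ m * ((m : ℝ) + α)⁻¹ ^ q) atTop
      (𝓝 (lerchPhi c q α)) := by
  have hq0 : q ≠ 0 := by omega
  simp only [lerchPhi, if_neg hq0, inv_pow, ← div_eq_mul_inv]
  refine tendsto_nhds_limUnder ?_
  simp only [div_eq_mul_inv]
  rcases hc with rfl | rfl
  · have hs : Summable fun m : ℕ => (((m : ℝ) + α) ^ q)⁻¹ := by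
      have h1 : (1 : ℝ) < (q : ℝ) := by
        have := hcq rfl
        exact_mod_cast (by omega : 1 < q)
      refine ((Real.summable_one_div_nat_add_rpow α q).mpr h1).congr fun m => ?_
      have : 0 < (m : ℝ) + α := by positivity
      rw [abs_of_pos this, Real.rpow_natCast, one_div]
    refine ⟨∑' m : ℕ, (((m : ℝ) + α) ^ q)⁻¹, ?_⟩
    simpa using hs.hasSum.tendsto_sum_nat
  · exact (antitone_inv_nat_add_pow hα q).tendsto_alternating_series_of_tendsto_zero
      (tendsto_inv_nat_add_pow α hq0)

/-- Consecutive partial sums bracket the limit, and they differ by one term. -/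
theorem abs_alternating_series_sub_le {f : ℕ → ℝ} {l : ℝ} (hf : Antitone f)
    (hl : Tendsto (fun n ↦ ∑ i ∈ Finset.range n, (-1) ^ i * f i) atTop (𝓝 l)) (k : ℕ) :
    |∑ i ∈ Finset.range k, (-1) ^ i * f i - l| ≤ f k := by
  rcases Nat.even_or_odd' k with ⟨j, rfl | rfl⟩
  · have h1 := hf.alternating_series_le_tendsto hl j
    have h2 := hf.tendsto_le_alternating_series hl j
    rw [Finset.sum_range_succ, pow_mul] at h2
    simp only [even_two, Even.neg_pow, one_pow, one_mul] at h2
    rw [abs_le]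
    constructor <;> linarith
  · have h1 := hf.tendsto_le_alternating_series hl j
    have h2 := hf.alternating_series_le_tendsto hl (j + 1)
    rw [show 2 * (j + 1) = 2 * j + 1 + 1 by ring, Finset.sum_range_succ, pow_succ, pow_mul] at h2
    simp only [even_two, Even.neg_pow, one_pow, one_mul] at h2
    rw [abs_le]
    constructor <;> linarith

/-- The remainder of the Lerch series is `O(1 / N)`. -/
theorem exists_abs_sum_sub_lerchPhi_le {c : ℝ} {q : ℕ} (hc : c = 1 ∨ c = -1) (hq : 1 ≤ q)
    (hcq : c = 1 → q ≠ 1) :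
    ∃ C : ℝ, 0 ≤ C ∧ ∀ N : ℕ,
      |∑ m ∈ Finset.range N, c ^ m * ((m : ℝ) + 1 / 2)⁻¹ ^ q - lerchPhi c q (1 / 2)| ≤
        C / ((N : ℝ) + 1) := by
  have hl := tendsto_lerchPhi hc hq (by norm_num : (0 : ℝ) < 1 / 2) hcq
  have hinv (N : ℕ) : ((N : ℝ) + 1 / 2)⁻¹ ≤ 2 / ((N : ℝ) + 1) := by
    rw [inv_le_comm₀ (by positivity) (by positivity), inv_div]
    have : (0 : ℝ) ≤ N := N.cast_nonneg
    linarith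
  have hone (N : ℕ) : 1 / ((N : ℝ) + 1) ≤ 1 := by
    rw [div_le_one (by positivity)]
    have : (0 : ℝ) ≤ N := N.cast_nonneg
    linarith
  have hpow (N k : ℕ) : ((N : ℝ) + 1 / 2)⁻¹ ^ k ≤ 2 ^ k * (1 / ((N : ℝ) + 1)) ^ k := by
    rw [← mul_pow]
    refine pow_le_pow_left₀ (by positivity) ((hinv N).trans (le_of_eq (by ring))) k
  rcases hc with rfl | rfl
  · have hq2 : 2 ≤ q := by have := hcq rfl; omega
    refine ⟨2 ^ q * 2, by positivity, fun N => ?_⟩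
    -- A telescoping majorant, from 1/(m+1)² ≤ 2(1/(m+1) - 1/(m+2)).
    have hterm (m : ℕ) : ((m : ℝ) + 1 / 2)⁻¹ ^ q ≤
        2 ^ q * 2 * (1 / ((m : ℝ) + 1)) - 2 ^ q * 2 * (1 / (((m + 1 : ℕ) : ℝ) + 1)) := by
      have h1 : (1 / ((m : ℝ) + 1)) ^ q ≤ (1 / ((m : ℝ) + 1)) ^ 2 :=
        pow_le_pow_of_le_one (by positivity) (hone m) hq2
      have h2 : (1 / ((m : ℝ) + 1)) ^ 2 ≤ 2 * (1 / ((m : ℝ) + 1)) - 2 * (1 / (((m + 1 : ℕ) : ℝ) + 1)) := by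
        have hm : (0 : ℝ) ≤ m := m.cast_nonneg
        push_cast
        rw [← sub_nonneg]
        have : 2 * (1 / ((m : ℝ) + 1)) - 2 * (1 / ((m : ℝ) + 1 + 1)) - (1 / ((m : ℝ) + 1)) ^ 2 =
            m / ((m + 1) ^ 2 * (m + 2)) := by
          field_simp
          ring
        rw [this]
        positivity
      calc _ ≤ 2 ^ q * (1 / ((m : ℝ) + 1)) ^ q := hpow m q
        _ ≤ 2 ^ q * (2 * (1 / ((m : ℝ) + 1)) - 2 * (1 / (((m + 1 : ℕ) : ℝ) + 1))) := by
            gcongr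
            exact h1.trans h2
        _ = _ := by ring
    have hfin (k : ℕ) : |∑ m ∈ Finset.range N, (1 : ℝ) ^ m * ((m : ℝ) + 1 / 2)⁻¹ ^ q -
        ∑ m ∈ Finset.range (N + k), (1 : ℝ) ^ m * ((m : ℝ) + 1 / 2)⁻¹ ^ q| ≤
        2 ^ q * 2 / ((N : ℝ) + 1) := by
      rw [Finset.sum_range_add, sub_add_cancel_left, abs_neg, abs_of_nonneg
        (Finset.sum_nonneg fun i _ => by positivity)]
      calc _ ≤ ∑ i ∈ Finset.range k, (2 ^ q * 2 * (1 / (((N + i : ℕ) : ℝ) + 1)) -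
              2 ^ q * 2 * (1 / (((N + (i + 1) : ℕ) : ℝ) + 1))) := by
            refine Finset.sum_le_sum fun i _ => ?_
            rw [one_pow, one_mul]
            exact hterm (N + i)
        _ = 2 ^ q * 2 * (1 / ((N : ℝ) + 1)) - 2 ^ q * 2 * (1 / (((N + k : ℕ) : ℝ) + 1)) := by
            rw [Finset.sum_range_sub' (fun i => 2 ^ q * 2 * (1 / (((N + i : ℕ) : ℝ) + 1)))]
            simp
        _ ≤ _ := by
            have : (0 : ℝ) ≤ 2 ^ q * 2 * (1 / (((N + k : ℕ) : ℝ) + 1)) := by positivity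
            rw [mul_one_div]
            linarith
    refine le_of_tendsto ((tendsto_const_nhds.sub (hl.comp (tendsto_add_atTop_nat N))).abs)
      (Eventually.of_forall fun k => ?_)
    have := hfin k
    rwa [add_comm N k] at this
  · refine ⟨2 ^ q, by positivity, fun N => ?_⟩
    have := abs_alternating_series_sub_le (f := fun m : ℕ => ((m : ℝ) + 1 / 2)⁻¹ ^ q)
      (by simpa using antitone_inv_nat_add_pow (by norm_num : (0 : ℝ) < 1 / 2) q)
      hl N
    refine this.trans ((hpow N q).trans ?_)
    rw [← mul_one_div (2 ^ q : ℝ)]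
    exact mul_le_mul_of_nonneg_left (pow_le_of_le_one (n := q) (by positivity) (hone N) (by omega))
      (by positivity)

/-! ### A convolution estimate -/

/-- The convolution of two harmonic sequences is `O(N ^ (-1 / 2))`, uniformly in the truncation. -/
theorem exists_sum_inv_mul_inv_abs_sub_le :
    ∃ K : ℝ, ∀ N M : ℕ, ∑ m ∈ Finset.range M, 1 / (((m : ℝ) + 1) * (|(m : ℝ) + 1 - N| + 1)) ≤
      K / √((N : ℝ) + 1) := by
  -- The exponent 3/2 is summable over ℤ and leaves a spare power 1/2 for the decay in N; the shift
  -- 1/2 avoids a zero denominator.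
  set h : ℤ → ℝ := fun j => 1 / |(j : ℝ) + 1 / 2| ^ (3 / 2 : ℝ) with hh
  have hs : Summable h := (Real.summable_one_div_int_add_rpow (1 / 2) (3 / 2)).mpr (by norm_num)
  have hnn (j : ℤ) : 0 ≤ h j := by positivity
  have hne (j : ℤ) : (0 : ℝ) < |(j : ℝ) + 1 / 2| := by
    rw [abs_pos]
    intro h0
    have h1 : (2 * j + 1 : ℝ) = 0 := by linarith
    have h2 : 2 * j + 1 = 0 := by exact_mod_cast h1
    omega
  have hle (j : ℤ) (x : ℝ) (hx : |(j : ℝ) + 1 / 2| ≤ x) : 1 / x ^ (3 / 2 : ℝ) ≤ h j := by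
    have := hne j
    exact one_div_le_one_div_of_le (by positivity)
      (Real.rpow_le_rpow this.le hx (by norm_num))
  -- The larger of x and y is at least both A/2 and the smaller one; each bound is used on one
  -- square root of it.
  have key (x y A : ℝ) (hx : 0 < x) (hy : 0 < y) (hA : 0 < A) (hxy : A ≤ x + y) :
      1 / (x * y) ≤ 2 / √A * (1 / x ^ (3 / 2 : ℝ) + 1 / y ^ (3 / 2 : ℝ)) := by
    have h32 (x : ℝ) (hx : 0 < x) : x ^ (3 / 2 : ℝ) = x * √x := by
      rw [Real.sqrt_eq_rpow, ← Real.rpow_one_add' hx.le (by norm_num)]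
      norm_num
    have main (x y : ℝ) (hx : 0 < x) (hy : 0 < y) (hxy : A ≤ x + y) (hle : x ≤ y) :
        1 / (x * y) ≤ 2 / √A * (1 / x ^ (3 / 2 : ℝ)) := by
      rw [h32 x hx, div_mul_div_comm, div_le_div_iff₀ (by positivity) (by positivity)]
      have h1 : √A ≤ 2 * √y := by
        rw [Real.sqrt_le_left (by positivity), mul_pow, Real.sq_sqrt hy.le]
        linarith
      have h2 : √x ≤ √y := Real.sqrt_le_sqrt hle
      have h3 : √A * √x ≤ 2 * √y * √y := by gcongr
      rw [mul_assoc 2, Real.mul_self_sqrt hy.le] at h3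
      nlinarith
    have hn (x : ℝ) (hx : 0 < x) : 0 ≤ 2 / √A * (1 / x ^ (3 / 2 : ℝ)) := by positivity
    rw [mul_add]
    rcases le_total x y with hle | hle
    · linarith [main x y hx hy hxy hle, hn y hy]
    · rw [mul_comm x y]
      linarith [main y x hy hx (by linarith) hle, hn x hx]
  have hshift (N M : ℕ) : ∑ m ∈ Finset.range M, h ((m : ℤ) - N) ≤ ∑' j, h j := by
    have hinj : Function.Injective fun m : ℕ => (m : ℤ) - N := by
      intro i j hij
      simpa using hij
    rw [← Finset.sum_image (s := Finset.range M) (g := fun m : ℕ => (m : ℤ) - N) (f := h)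
      fun i _ j _ hij => hinj hij]
    exact hs.sum_le_tsum _ fun j _ => hnn j
  refine ⟨4 * ∑' j, h j, fun N M => ?_⟩
  calc _ ≤ ∑ m ∈ Finset.range M, 2 / √((N : ℝ) + 1) * (h ((m : ℤ) - (0 : ℕ)) + h ((m : ℤ) - N)) := by
        refine Finset.sum_le_sum fun m _ => (key _ _ _ (by positivity) (by positivity)
          (by positivity : (0 : ℝ) < N + 1) ?_).trans ?_
        · have := neg_abs_le ((m : ℝ) + 1 - N)
          linarith
        · gcongr
          · refine hle _ _ ?_
            push_cast
            rw [abs_of_nonneg] <;> linarith [m.cast_nonneg (α := ℝ)]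
          · refine hle _ _ ?_
            push_cast
            rw [show (m : ℝ) - N + 1 / 2 = (m + 1 - N) + (-(1 / 2)) by ring]
            refine (abs_add_le _ _).trans ?_
            norm_num
    _ = 2 / √((N : ℝ) + 1) * (∑ m ∈ Finset.range M, h ((m : ℤ) - (0 : ℕ)) +
          ∑ m ∈ Finset.range M, h ((m : ℤ) - N)) := by
        rw [← Finset.mul_sum, Finset.sum_add_distrib]
    _ ≤ 2 / √((N : ℝ) + 1) * (∑' j, h j + ∑' j, h j) := by
        gcongr
        · exact hshift 0 M
        · exact hshift N M
    _ = _ := by ring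

/-! ### Symmetric bilateral sums -/

/-- Real part of the Mittag-Leffler expansion of the cotangent; it covers the case c = k = 1, where
the two halves diverge separately. -/
theorem tendsto_sum_cot {s : ℝ} (hs0 : 0 < s) (hs1 : s < 1) :
    Tendsto (fun M : ℕ => s⁻¹ + ∑ m ∈ Finset.range M,
      ((s - ((m : ℝ) + 1))⁻¹ + (s + ((m : ℝ) + 1))⁻¹)) atTop
      (𝓝 (Real.pi * Real.cot (Real.pi * s))) := by
  have hz : (s : ℂ) ∈ Complex.integerComplement := by
    rintro ⟨k, hk⟩
    have hk' : (k : ℝ) = s := by exact_mod_cast hk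
    rw [← hk'] at hs0 hs1
    have h0 : 0 < k := by exact_mod_cast hs0
    have h1 : k < 1 := by exact_mod_cast hs1
    omega
  have h := (Complex.continuous_re.tendsto _).comp (tendsto_logDeriv_euler_cot_sub hz)
  have hlim : ((Real.pi : ℂ) * Complex.cot (Real.pi * s) - 1 / s).re =
      Real.pi * Real.cot (Real.pi * s) - s⁻¹ := by
    rw [show (Real.pi : ℂ) * Complex.cot (Real.pi * s) - 1 / s =
      ((Real.pi * Real.cot (Real.pi * s) - s⁻¹ : ℝ) : ℂ) by push_cast; rw [one_div],
      Complex.ofReal_re]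
  rw [hlim] at h
  have h2 := h.const_add s⁻¹
  rw [add_sub_cancel] at h2
  refine h2.congr fun M => ?_
  simp only [Function.comp_apply, Complex.re_sum, cotTerm]
  congr 1
  refine Finset.sum_congr rfl fun m _ => ?_
  rw [show (1 / ((s : ℂ) - (m + 1)) + 1 / ((s : ℂ) + (m + 1))) =
    (((s - ((m : ℝ) + 1))⁻¹ + (s + ((m : ℝ) + 1))⁻¹ : ℝ) : ℂ) by push_cast; simp only [one_div],
    Complex.ofReal_re]

/-- The symmetric bilateral sum of `cᵐ (s - m)⁻ᵏ` is `Θ`. -/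
theorem tendsto_bilateral_lerchTheta {c : ℝ} (hc : c = 1 ∨ c = -1) {k : ℕ} (hk : 1 ≤ k)
    {s r : ℝ} (hs0 : 0 < s) (hs1 : s < r) :
    Tendsto (fun M : ℕ => (s / r)⁻¹ ^ k + ∑ m ∈ Finset.range M,
      c ^ (m + 1) * ((s / r - ((m : ℝ) + 1))⁻¹ ^ k + (s / r + ((m : ℝ) + 1))⁻¹ ^ k)) atTop
      (𝓝 (lerchTheta c k s r)) := by
  have hr : 0 < r := hs0.trans hs1
  have h0 : 0 < s / r := by positivity
  have h1 : s / r < 1 := (div_lt_one hr).mpr hs1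
  rw [lerchTheta]
  split_ifs with hck
  · obtain ⟨rfl, rfl⟩ := hck
    simpa [mul_div_assoc] using tendsto_sum_cot h0 h1
  · have hck' : c = 1 → k ≠ 1 := fun h h' => hck ⟨h, h'⟩
    have hsub : (r - s) / r = 1 - s / r := by field_simp
    rw [hsub]
    have hA := (tendsto_lerchPhi hc hk h0 hck').comp (tendsto_add_atTop_nat 1)
    have hB := (tendsto_lerchPhi hc hk (by linarith : 0 < 1 - s / r) hck').const_mul
      (c * (-1) ^ k)
    refine (hA.add hB).congr fun M => ?_
    simp only [Function.comp_apply]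
    rw [Finset.sum_range_succ', Finset.mul_sum]
    simp only [mul_add, Finset.sum_add_distrib]
    have : ∑ m ∈ Finset.range M, c ^ (m + 1) * (s / r - ((m : ℝ) + 1))⁻¹ ^ k =
        ∑ m ∈ Finset.range M, c * (-1) ^ k * (c ^ m * ((m : ℝ) + (1 - s / r))⁻¹ ^ k) := by
      refine Finset.sum_congr rfl fun m _ => ?_
      rw [show s / r - ((m : ℝ) + 1) = -1 * ((m : ℝ) + (1 - s / r)) by ring, mul_inv, mul_pow,
        inv_neg, inv_one]
      ring
    rw [this]
    simp only [Nat.cast_add, Nat.cast_one, pow_zero, CharP.cast_eq_zero, zero_add, one_mul,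
      add_comm (s / r)]
    ring

/-- Moving y by 1 slides the summation window by one place, so only two end terms change. -/
theorem bilateral_sum_add_one {c : ℝ} (hc : c ^ 2 = 1) (y : ℝ) (k M : ℕ) :
    (y + 1)⁻¹ ^ k + ∑ m ∈ Finset.range M,
      c ^ (m + 1) * ((y + 1 - ((m : ℝ) + 1))⁻¹ ^ k + (y + 1 + ((m : ℝ) + 1))⁻¹ ^ k) =
    c * (y⁻¹ ^ k + ∑ m ∈ Finset.range M,
      c ^ (m + 1) * ((y - ((m : ℝ) + 1))⁻¹ ^ k + (y + ((m : ℝ) + 1))⁻¹ ^ k)) +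
    (c ^ M * (y + ((M : ℝ) + 1))⁻¹ ^ k - c ^ (M + 1) * (y - M)⁻¹ ^ k) := by
  induction M with
  | zero => simp
  | succ M ih =>
    rw [Finset.sum_range_succ, ← add_assoc, ih, Finset.sum_range_succ]
    rw [show y + 1 - ((M : ℝ) + 1) = y - M by ring,
      show y + 1 + ((M : ℝ) + 1) = y + (((M + 1 : ℕ) : ℝ) + 1) by push_cast; ring]
    push_cast
    linear_combination (-c ^ M * (y + ((M : ℝ) + 1))⁻¹ ^ k) * hc

theorem tendsto_bilateral_lerchTheta_add_nat {c : ℝ} (hc : c = 1 ∨ c = -1) {k : ℕ} (hk : 1 ≤ k)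
    {s r : ℝ} (hs0 : 0 < s) (hs1 : s < r) (t : ℕ) :
    Tendsto (fun M : ℕ => (s / r + t)⁻¹ ^ k + ∑ m ∈ Finset.range M,
      c ^ (m + 1) * ((s / r + t - ((m : ℝ) + 1))⁻¹ ^ k + (s / r + t + ((m : ℝ) + 1))⁻¹ ^ k)) atTop
      (𝓝 (c ^ t * lerchTheta c k s r)) := by
  have hc2 : c ^ 2 = 1 := by rcases hc with rfl | rfl <;> norm_num
  have hk0 : k ≠ 0 := by omega
  induction t with
  | zero => simpa using tendsto_bilateral_lerchTheta hc hk hs0 hs1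
  | succ t ih =>
    have hcn : ‖c‖ = 1 := by rcases hc with rfl | rfl <;> simp
    have hsmall (f : ℕ → ℝ) (hf : Tendsto f atTop (𝓝 0)) (i : ℕ) :
        Tendsto (fun M => c ^ (M + i) * f M ^ k) atTop (𝓝 0) := by
      refine squeeze_zero_norm (a := fun M => ‖f M ^ k‖) (fun M => ?_) ?_
      · rw [norm_mul, norm_pow, hcn, one_pow, one_mul]
      · simpa [hk0] using (hf.pow k).norm
    have h1 := hsmall (fun M => (s / r + t + ((M : ℝ) + 1))⁻¹) (tendsto_inv_atTop_zero.comp <|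
      tendsto_atTop_add_const_left _ _ <| tendsto_atTop_add_const_right _ _
        tendsto_natCast_atTop_atTop) 0
    have h2 := hsmall (fun M => (s / r + t - M)⁻¹) (tendsto_inv_atBot_zero.comp <| by
      simp only [sub_eq_add_neg]
      exact tendsto_atBot_add_const_left _ _ <| tendsto_neg_atTop_atBot.comp
        tendsto_natCast_atTop_atTop) 1
    have h3 := (ih.const_mul c).add (h1.sub h2)
    rw [sub_zero, add_zero, ← mul_assoc, ← pow_succ'] at h3
    refine h3.congr fun M => ?_
    have := bilateral_sum_add_one hc2 (s / r + t) k M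
    simp only [show s / r + ((t + 1 : ℕ) : ℝ) = s / r + t + 1 by push_cast; ring]
    exact this.symm

theorem sum_range_one_add_neg_one_pow_mul (G : ℕ → ℝ) (p : ℕ) :
    ∑ j ∈ Finset.range (p + 1), (1 + (-1) ^ j) * G j =
      ∑ k ∈ Finset.range (p / 2 + 1), 2 * G (2 * k) := by
  have h (j : ℕ) : ∑ i ∈ Finset.range (2 * j + 1), (1 + (-1) ^ i) * G i =
      ∑ k ∈ Finset.range (j + 1), 2 * G (2 * k) := by
    induction j with
    | zero => norm_num
    | succ j ih =>
      rw [show 2 * (j + 1) + 1 = 2 * j + 1 + 1 + 1 by ring, Finset.sum_range_succ,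
        Finset.sum_range_succ, ih, Finset.sum_range_succ _ (j + 1), pow_succ, pow_succ, pow_mul]
      norm_num [mul_add]
      left
      rw [pow_succ, pow_mul]
      norm_num
  rcases Nat.even_or_odd' p with ⟨j, rfl | rfl⟩
  · rw [h, Nat.mul_div_cancel_left _ two_pos]
  · rw [Finset.sum_range_succ, h, pow_succ, pow_mul, show (2 * j + 1) / 2 = j by omega]
    norm_num

theorem tendsto_sum_pow_add_neg_pow {c : ℝ} (hc : c = 1 ∨ c = -1) {i : ℕ} (hi : 1 ≤ i) :
    Tendsto (fun M : ℕ => ∑ m ∈ Finset.range M,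
      c ^ (m + 1) * (((m : ℝ) + 1)⁻¹ ^ i + (-((m : ℝ) + 1))⁻¹ ^ i)) atTop
      (𝓝 ((1 + (-1) ^ i) * (c * lerchPhi c i 1))) := by
  have h : (fun M : ℕ => ∑ m ∈ Finset.range M,
      c ^ (m + 1) * (((m : ℝ) + 1)⁻¹ ^ i + (-((m : ℝ) + 1))⁻¹ ^ i)) = fun M : ℕ =>
      (1 + (-1) ^ i) * (c * ∑ m ∈ Finset.range M, c ^ m * ((m : ℝ) + 1)⁻¹ ^ i) := by
    funext M
    rw [Finset.mul_sum, Finset.mul_sum]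
    refine Finset.sum_congr rfl fun m _ => ?_
    rw [inv_neg, neg_pow (((m : ℝ) + 1)⁻¹)]
    ring
  rw [h]
  -- For i = 1 the factor 1 + (-1)ⁱ vanishes, so the value of `lerchPhi` outside its domain is
  -- harmless.
  by_cases hi1 : i = 1
  · subst hi1
    simp
  · exact ((tendsto_lerchPhi hc hi one_pos fun _ => hi1).const_mul c).const_mul _

/-! ### Closed form of the sum over the integers -/

/-- The closed form of `∑ cᵐ / (mᵖ (y - m)ᑫ)` over the nonzero integers `m`, summed symmetrically,
for `y = s / r + t`. -/
noncomputable def bilateralValue (c : ℝ) (p q : ℕ) (s r : ℝ) (t : ℕ) : ℝ :=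
  ∑ k ∈ Finset.range (p / 2 + 1), 2 * (((p + q - 2 * k - 1).choose (q - 1) : ℝ) *
    (s / r + t)⁻¹ ^ (p + q - 2 * k) * (c * lerchPhi c (2 * k) 1)) +
  ∑ k ∈ Finset.range q, ((p + k - 1).choose k : ℝ) * (s / r + t)⁻¹ ^ (p + k) *
    (c ^ t * lerchTheta c (q - k) s r)

theorem tendsto_bilateralValue {c : ℝ} (hc : c = 1 ∨ c = -1) {p q : ℕ} (hp : 1 ≤ p) (hq : 1 ≤ q)
    {s r : ℝ} (hs0 : 0 < s) (hs1 : s < r) (t : ℕ) :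
    Tendsto (fun M : ℕ => ∑ m ∈ Finset.range M, c ^ (m + 1) * (((m : ℝ) + 1)⁻¹ ^ p *
      ((s / r + t - ((m : ℝ) + 1))⁻¹ ^ q + (-1) ^ p * (s / r + t + ((m : ℝ) + 1))⁻¹ ^ q))) atTop
      (𝓝 (bilateralValue c p q s r t)) := by
  have hr : 0 < r := hs0.trans hs1
  have hsr0 : 0 < s / r := by positivity
  have hsr1 : s / r < 1 := (div_lt_one hr).mpr hs1
  set y := s / r + t with hy
  have hy0 : 0 < y := by positivity
  have hne (m : ℕ) : y - ((m : ℝ) + 1) ≠ 0 := by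
    intro h0
    rcases le_or_gt t m with h | h
    · have : (t : ℝ) ≤ m := by exact_mod_cast h
      linarith
    · have : (m : ℝ) + 1 ≤ t := by exact_mod_cast h
      linarith
  have hterm (m : ℕ) : c ^ (m + 1) * (((m : ℝ) + 1)⁻¹ ^ p *
      ((y - ((m : ℝ) + 1))⁻¹ ^ q + (-1) ^ p * (y + ((m : ℝ) + 1))⁻¹ ^ q)) =
      ∑ i ∈ Finset.range p, ((q + i - 1).choose i : ℝ) * y⁻¹ ^ (q + i) *
        (c ^ (m + 1) * (((m : ℝ) + 1)⁻¹ ^ (p - i) + (-((m : ℝ) + 1))⁻¹ ^ (p - i))) +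
      ∑ k ∈ Finset.range q, ((p + k - 1).choose k : ℝ) * y⁻¹ ^ (p + k) *
        (c ^ (m + 1) * ((y - ((m : ℝ) + 1))⁻¹ ^ (q - k) + (y + ((m : ℝ) + 1))⁻¹ ^ (q - k))) := by
    have hm : (m : ℝ) + 1 ≠ 0 := by positivity
    have h1 := inv_pow_mul_inv_pow_eq_sum_partialFraction hm (hne m) hy0.ne' (by ring) p q
      (by omega)
    have h2 := inv_pow_mul_inv_pow_eq_sum_partialFraction (neg_ne_zero.mpr hm)
      (by positivity : y + ((m : ℝ) + 1) ≠ 0) hy0.ne' (by ring) p q (by omega)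
    have h3 : (-((m : ℝ) + 1))⁻¹ ^ p = (-1) ^ p * ((m : ℝ) + 1)⁻¹ ^ p := by
      rw [inv_neg, neg_pow]
    rw [h3] at h2
    calc _ = c ^ (m + 1) * (((m : ℝ) + 1)⁻¹ ^ p * (y - ((m : ℝ) + 1))⁻¹ ^ q) +
          c ^ (m + 1) * ((-1) ^ p * ((m : ℝ) + 1)⁻¹ ^ p * (y + ((m : ℝ) + 1))⁻¹ ^ q) := by ring
      _ = _ := by
        rw [h1, h2]
        simp only [mul_add, Finset.mul_sum, Finset.sum_add_distrib]
        rw [add_add_add_comm]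
        refine congrArg₂ _ (congrArg₂ _ ?_ ?_) (congrArg₂ _ ?_ ?_) <;>
          exact Finset.sum_congr rfl fun _ _ => by ring
  have hD := tendsto_finsetSum (Finset.range p) fun i hi =>
    (tendsto_sum_pow_add_neg_pow hc (i := p - i) (by have := Finset.mem_range.mp hi; omega)).const_mul
      (((q + i - 1).choose i : ℝ) * y⁻¹ ^ (q + i))
  -- The symmetric sums for Θ contain m = 0, which the double series omits; hence the subtraction.
  have hE := tendsto_finsetSum (Finset.range q) fun k hk =>
    ((tendsto_bilateral_lerchTheta_add_nat hc (k := q - k)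
      (by have := Finset.mem_range.mp hk; omega) hs0 hs1 t).sub_const (y⁻¹ ^ (q - k))).const_mul
      (((p + k - 1).choose k : ℝ) * y⁻¹ ^ (p + k))
  have hval : bilateralValue c p q s r t =
      ∑ i ∈ Finset.range p, ((q + i - 1).choose i : ℝ) * y⁻¹ ^ (q + i) *
        ((1 + (-1) ^ (p - i)) * (c * lerchPhi c (p - i) 1)) +
      ∑ k ∈ Finset.range q, ((p + k - 1).choose k : ℝ) * y⁻¹ ^ (p + k) *
        (c ^ t * lerchTheta c (q - k) s r - y⁻¹ ^ (q - k)) := by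
    simp only [bilateralValue, ← hy, mul_sub, Finset.sum_sub_distrib]
    rw [← add_sub_assoc, add_sub_right_comm]
    congr 1
    rw [← sum_range_one_add_neg_one_pow_mul (fun j => ((p + q - j - 1).choose (q - 1) : ℝ) *
      y⁻¹ ^ (p + q - j) * (c * lerchPhi c j 1)), Finset.sum_range_succ', sub_eq_add_neg,
      ← Finset.sum_range_reflect]
    congr 1
    · refine Finset.sum_congr rfl fun i hi => ?_
      have hi' := Finset.mem_range.mp hi
      rw [show p - 1 - i + 1 = p - i by omega, show p + q - (p - i) = q + i by omega,
        ← Nat.choose_symm_of_eq_add (show q + i - 1 = i + (q - 1) by omega)]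
      ring
    · have h0 : c * lerchPhi c 0 1 = -(1 / 2) := by rcases hc with rfl | rfl <;> norm_num [lerchPhi]
      have hsum : ∑ k ∈ Finset.range q, ((p + k - 1).choose k : ℝ) * y⁻¹ ^ (p + k) * y⁻¹ ^ (q - k) =
          ((p + q - 1).choose (q - 1) : ℝ) * y⁻¹ ^ (p + q) := by
        rw [← sum_range_choose_add_sub_one p q hp hq, Nat.cast_sum, Finset.sum_mul]
        refine Finset.sum_congr rfl fun k hk => ?_
        have hk' := Finset.mem_range.mp hk
        rw [mul_assoc, ← pow_add, show p + k + (q - k) = p + q by omega]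
      rw [hsum, h0]
      simp only [Nat.sub_zero, pow_zero]
      ring
  rw [hval]
  refine (hD.add hE).congr fun M => ?_
  simp only [hterm, Finset.sum_add_distrib]
  congr 1
  · rw [Finset.sum_comm]
    exact Finset.sum_congr rfl fun i _ => by rw [Finset.mul_sum]
  · rw [Finset.sum_comm]
    exact Finset.sum_congr rfl fun i _ => by rw [add_sub_cancel_left, Finset.mul_sum]

/-! ### Half-integer nodes -/

/-- The half-integer `r + 1 / 2`, scaled by `1 / n`. -/
noncomputable def oddNode (n r : ℕ) : ℝ := ((r : ℝ) + 1 / 2) / n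

/-- The sum of `aʳ / yʳᑫ` over the nodes `0 < y_r < m`. -/
noncomputable def oddNodeSum (a : ℝ) (q n m : ℕ) : ℝ :=
  ∑ r ∈ Finset.range (n * m), a ^ r * (oddNode n r)⁻¹ ^ q

theorem oddNode_add {n : ℕ} (hn : 1 ≤ n) (r m : ℕ) : oddNode n (n * m + r) = oddNode n r + m := by
  have : (n : ℝ) ≠ 0 := by positivity
  simp only [oddNode]
  push_cast
  field_simp
  ring

theorem oddNodeSum_add_sub {a : ℝ} {q n : ℕ} (hn : 1 ≤ n) (N m : ℕ) :
    oddNodeSum a q n (m + N) - oddNodeSum a q n m =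
      ∑ r ∈ Finset.range (n * N), a ^ (n * m + r) * (oddNode n r + m)⁻¹ ^ q := by
  rw [oddNodeSum, oddNodeSum, mul_add, Finset.sum_range_add, add_sub_cancel_left]
  simp only [oddNode_add hn]

theorem pow_mul_self_eq_one_of_eq_or {a : ℝ} (ha : a = 1 ∨ a = -1) (k : ℕ) : a ^ k * a ^ k = 1 := by
  rcases ha with rfl | rfl <;> simp [← mul_pow]

theorem sum_oddNode_add {a : ℝ} (ha : a = 1 ∨ a = -1) {q n : ℕ} (hn : 1 ≤ n) (N m : ℕ) :
    ∑ r ∈ Finset.range (n * N), a ^ r * (oddNode n r + m)⁻¹ ^ q =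
      a ^ (n * m) * (oddNodeSum a q n (N + m) - oddNodeSum a q n m) := by
  rw [add_comm N m, oddNodeSum_add_sub hn, Finset.mul_sum]
  refine Finset.sum_congr rfl fun r _ => ?_
  rw [pow_add]
  linear_combination -(a ^ r * (oddNode n r + m)⁻¹ ^ q) * pow_mul_self_eq_one_of_eq_or ha (n * m)

/-- All nodes lie left of m. Reversing their order turns y_r - m into -(y_r + m - N), giving (-1)ᑫ,
and the -1 in the reversed index gives the extra factor a. -/
theorem sum_oddNode_sub_of_le {a : ℝ} (ha : a = 1 ∨ a = -1) {q n : ℕ} (hn : 1 ≤ n) {N m : ℕ}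
    (h : N ≤ m) :
    ∑ r ∈ Finset.range (n * N), a ^ r * (oddNode n r - m)⁻¹ ^ q =
      (-1) ^ q * a * a ^ (n * m) * (oddNodeSum a q n m - oddNodeSum a q n (m - N)) := by
  obtain ⟨d, rfl⟩ := Nat.exists_eq_add_of_le' h
  rw [Nat.add_sub_cancel, oddNodeSum_add_sub hn, ← Finset.sum_range_reflect, Finset.mul_sum]
  refine Finset.sum_congr rfl fun r hr => ?_
  have hr' := Finset.mem_range.mp hr
  have hn0 : (n : ℝ) ≠ 0 := by positivity
  have hnode : oddNode n (n * N - 1 - r) - ((d + N : ℕ) : ℝ) = -(oddNode n r + d) := by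
    have : ((n * N - 1 - r : ℕ) : ℝ) = n * N - 1 - r := by
      rw [Nat.cast_sub (by omega), Nat.cast_sub (by omega)]
      push_cast
      ring
    simp only [oddNode, this]
    push_cast
    field_simp
    ring
  have hpow : a ^ (n * N - 1 - r) = a * a ^ (n * (d + N)) * a ^ (n * d + r) := by
    have h1 := pow_mul_self_eq_one_of_eq_or ha (n * d)
    have h2 := pow_mul_self_eq_one_of_eq_or ha (1 + r)
    have h3 : a ^ (n * N) = a ^ (n * N - 1 - r) * a ^ (1 + r) := by
      rw [← pow_add]
      congr 1
      omega
    rw [mul_add, pow_add, pow_add, h3]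
    rw [pow_add, pow_one] at h2 ⊢
    linear_combination -a ^ (n * N - 1 - r) * a ^ 2 * (a ^ r) ^ 2 * h1 - a ^ (n * N - 1 - r) * h2
  rw [hnode, hpow, inv_neg, neg_pow]
  ring

/-- Nodes left of m are reflected; those right of m are translated back to the origin. -/
theorem sum_oddNode_sub_of_ge {a : ℝ} (ha : a = 1 ∨ a = -1) {q n : ℕ} (hn : 1 ≤ n) {N m : ℕ}
    (h : m ≤ N) :
    ∑ r ∈ Finset.range (n * N), a ^ r * (oddNode n r - m)⁻¹ ^ q =
      (-1) ^ q * a * a ^ (n * m) * oddNodeSum a q n m +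
        a ^ (n * m) * oddNodeSum a q n (N - m) := by
  obtain ⟨d, rfl⟩ := Nat.exists_eq_add_of_le h
  rw [mul_add, Finset.sum_range_add, sum_oddNode_sub_of_le ha hn le_rfl, Nat.add_sub_cancel_left]
  simp only [oddNode_add hn, add_sub_cancel_right, pow_add, oddNodeSum, Nat.sub_self, mul_zero,
    Finset.range_zero, Finset.sum_empty, sub_zero, Finset.mul_sum, mul_assoc]

theorem inv_oddNode_pow (n r q : ℕ) :
    (oddNode n r)⁻¹ ^ q = (n : ℝ) ^ q * ((r : ℝ) + 1 / 2)⁻¹ ^ q := by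
  rw [oddNode, inv_div, div_eq_mul_inv, mul_pow]

theorem exists_abs_oddNodeSum_sub_le {a : ℝ} {q n : ℕ} (ha : a = 1 ∨ a = -1) (hq : 1 ≤ q)
    (hn : 1 ≤ n) (haq : a = 1 → q ≠ 1) :
    ∃ C : ℝ, 0 ≤ C ∧ ∀ m : ℕ,
      |oddNodeSum a q n m - (n : ℝ) ^ q * lerchPhi a q (1 / 2)| ≤ C / ((m : ℝ) + 1) := by
  obtain ⟨C, hC, h⟩ := exists_abs_sum_sub_lerchPhi_le ha hq haq
  refine ⟨(n : ℝ) ^ q * C, by positivity, fun m => ?_⟩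
  have : oddNodeSum a q n m = (n : ℝ) ^ q *
      ∑ r ∈ Finset.range (n * m), a ^ r * ((r : ℝ) + 1 / 2)⁻¹ ^ q := by
    rw [oddNodeSum, Finset.mul_sum]
    refine Finset.sum_congr rfl fun r _ => ?_
    rw [inv_oddNode_pow]
    ring
  rw [this, ← mul_sub, abs_mul, abs_of_nonneg (by positivity), mul_div_assoc]
  refine mul_le_mul_of_nonneg_left ((h _).trans ?_) (by positivity)
  gcongr
  exact Nat.le_mul_of_pos_left m hn

/-! ### Exchange of the two summations -/

/-- The double series over the nodes `y_r` and the nonzero integers may be summed in either order: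
the two families of truncations differ by a null sequence. -/
theorem tendsto_sum_bilateral_sub_sum_oddNodeSum {a b : ℝ} {p q n : ℕ} (hp : 1 ≤ p) (hq : 1 ≤ q)
    (hn : 1 ≤ n) (ha : a = 1 ∨ a = -1) (hb : b = 1 ∨ b = -1) (haq : a = 1 → q ≠ 1)
    (hpq : (-1) ^ q * a = -(-1) ^ p) {ℓ : ℕ → ℝ}
    (hℓ : ∀ r, Tendsto (fun M : ℕ => ∑ m ∈ Finset.range M,
      (a ^ n * b) ^ (m + 1) * (((m : ℝ) + 1)⁻¹ ^ p * ((oddNode n r - ((m : ℝ) + 1))⁻¹ ^ q +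
        (-1) ^ p * (oddNode n r + ((m : ℝ) + 1))⁻¹ ^ q))) atTop (𝓝 (ℓ r))) :
    Tendsto (fun N : ℕ => ∑ r ∈ Finset.range (n * N), a ^ r * ℓ r -
      ∑ m ∈ Finset.range N, b ^ (m + 1) * ((m : ℝ) + 1)⁻¹ ^ p *
        (2 * (-1) ^ p * ((n : ℝ) ^ q * lerchPhi a q (1 / 2) - oddNodeSum a q n (m + 1)) +
          (1 - (-1) ^ p) * ((n : ℝ) ^ q * lerchPhi a q (1 / 2)))) atTop (𝓝 0) := by
  obtain ⟨C, hC, hCe⟩ := exists_abs_oddNodeSum_sub_le ha hq hn haq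
  obtain ⟨K, hK⟩ := exists_sum_inv_mul_inv_abs_sub_le
  set g := oddNodeSum a q n with hg
  set γ := (n : ℝ) ^ q * lerchPhi a q (1 / 2) with hγ
  set T : ℕ → ℝ := fun m => b ^ (m + 1) * ((m : ℝ) + 1)⁻¹ ^ p *
    (2 * (-1) ^ p * (γ - g (m + 1)) + (1 - (-1) ^ p) * γ) with hT
  have hbabs (k : ℕ) : |b ^ k| = 1 := by rcases hb with rfl | rfl <;> simp
  have hpabs : |(-1 : ℝ) ^ p| = 1 := by simp
  have hcab (k : ℕ) : (a ^ n * b) ^ k * a ^ (n * k) = b ^ k := by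
    rw [mul_pow, ← pow_mul]
    linear_combination b ^ k * pow_mul_self_eq_one_of_eq_or ha (n * k)
  set W : ℕ → ℕ → ℝ := fun N m => ((m : ℝ) + 1)⁻¹ ^ p * ((a ^ n * b) ^ (m + 1) *
    (∑ r ∈ Finset.range (n * N), a ^ r * (oddNode n r - ((m + 1 : ℕ) : ℝ))⁻¹ ^ q +
      (-1) ^ p * ∑ r ∈ Finset.range (n * N), a ^ r * (oddNode n r + ((m + 1 : ℕ) : ℝ))⁻¹ ^ q))
    with hW
  have hlim (N : ℕ) : Tendsto (fun M => ∑ m ∈ Finset.range M, W N m) atTop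
      (𝓝 (∑ r ∈ Finset.range (n * N), a ^ r * ℓ r)) := by
    refine (tendsto_finsetSum _ fun r _ => (hℓ r).const_mul (a ^ r)).congr fun M => ?_
    simp only [Finset.mul_sum]
    rw [Finset.sum_comm]
    refine Finset.sum_congr rfl fun m _ => ?_
    simp only [hW, mul_add, Finset.mul_sum, ← Finset.sum_add_distrib]
    refine Finset.sum_congr rfl fun r _ => ?_
    push_cast
    ring
  -- The discrepancy combines at most four remainders g(j) - γ, all with j ≥ |m + 1 - N|; hence the
  -- constant 4C.
  have hbd (N m : ℕ) : |W N m - if m < N then T m else 0| ≤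
      4 * C * (1 / (((m : ℝ) + 1) * (|(m : ℝ) + 1 - N| + 1))) := by
    have he (j : ℕ) (hj : |(m : ℝ) + 1 - N| ≤ j) : |g j - γ| ≤ C / (|(m : ℝ) + 1 - N| + 1) :=
      (hCe j).trans (by gcongr)
    have hm0 : (0 : ℝ) ≤ m := m.cast_nonneg
    have hN0 : (0 : ℝ) ≤ N := N.cast_nonneg
    have hinv : ((m : ℝ) + 1)⁻¹ ^ p ≤ ((m : ℝ) + 1)⁻¹ :=
      pow_le_of_le_one (by positivity) (inv_le_one_of_one_le₀ (by linarith)) (by omega)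
    suffices ∃ R : ℝ, |R| ≤ 4 * C / (|(m : ℝ) + 1 - N| + 1) ∧
        (W N m - if m < N then T m else 0) = ((m : ℝ) + 1)⁻¹ ^ p * (b ^ (m + 1) * R) by
      obtain ⟨R, hR, hWR⟩ := this
      rw [hWR, abs_mul, abs_mul, hbabs, one_mul, abs_of_nonneg (by positivity)]
      calc _ ≤ ((m : ℝ) + 1)⁻¹ * (4 * C / (|(m : ℝ) + 1 - N| + 1)) := by gcongr
        _ = _ := by field_simp
    have h1 : |g (N + (m + 1)) - γ| ≤ C / (|(m : ℝ) + 1 - N| + 1) :=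
      he _ (by push_cast; rw [abs_le]; constructor <;> linarith)
    have hpos : 0 ≤ C / (|(m : ℝ) + 1 - N| + 1) := by positivity
    have h4 : 4 * C / (|(m : ℝ) + 1 - N| + 1) = 4 * (C / (|(m : ℝ) + 1 - N| + 1)) := by ring
    rw [h4]
    split_ifs with hmN
    · have h2 : |g (N - (m + 1)) - γ| ≤ C / (|(m : ℝ) + 1 - N| + 1) := by
        refine he _ ?_
        rw [Nat.cast_sub hmN, abs_sub_comm, abs_of_nonneg] <;> push_cast
        · rfl
        · have : ((m + 1 : ℕ) : ℝ) ≤ N := by exact_mod_cast hmN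
          push_cast at this
          linarith
      refine ⟨(-1) ^ p * (g (N + (m + 1)) - γ) + (g (N - (m + 1)) - γ), ?_, ?_⟩
      · refine (abs_add_le _ _).trans ?_
        rw [abs_mul, hpabs]
        linarith
      · simp only [hW, hT]
        rw [sum_oddNode_sub_of_ge ha hn (by omega : m + 1 ≤ N), sum_oddNode_add ha hn, hpq]
        linear_combination ((m : ℝ) + 1)⁻¹ ^ p * ((-1) ^ p * (g (N + (m + 1)) - 2 * g (m + 1)) +
          g (N - (m + 1))) * hcab (m + 1)
    · have hNm : (N : ℝ) ≤ m := by exact_mod_cast not_lt.mp hmN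
      have h2 : |g (m + 1 - N) - γ| ≤ C / (|(m : ℝ) + 1 - N| + 1) := by
        refine he _ ?_
        rw [Nat.cast_sub (by omega), abs_of_nonneg (by linarith)]
        push_cast
        rfl
      have h3 : |g (m + 1) - γ| ≤ C / (|(m : ℝ) + 1 - N| + 1) :=
        he _ (by push_cast; rw [abs_le]; constructor <;> linarith)
      refine ⟨(-1) ^ p * ((g (N + (m + 1)) - γ) - (g (m + 1) - γ) - (g (m + 1) - γ) +
        (g (m + 1 - N) - γ)), ?_, ?_⟩
      · rw [abs_mul, hpabs, one_mul]
        refine (abs_add_le _ _).trans ?_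
        have := abs_sub ((g (N + (m + 1)) - γ) - (g (m + 1) - γ)) (g (m + 1) - γ)
        have := abs_sub (g (N + (m + 1)) - γ) (g (m + 1) - γ)
        linarith
      · simp only [hW]
        rw [sum_oddNode_sub_of_le ha hn (by omega : N ≤ m + 1), sum_oddNode_add ha hn, hpq]
        linear_combination ((m : ℝ) + 1)⁻¹ ^ p * (-1) ^ p * (g (N + (m + 1)) - 2 * g (m + 1) +
          g (m + 1 - N)) * hcab (m + 1)
  have hfin (N M : ℕ) (hM : N ≤ M) : |∑ m ∈ Finset.range M, W N m - ∑ m ∈ Finset.range N, T m| ≤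
      4 * C * (K / √((N : ℝ) + 1)) := by
    have hfilter : ∑ m ∈ Finset.range N, T m =
        ∑ m ∈ Finset.range M, if m < N then T m else 0 := by
      rw [← Finset.sum_filter]
      congr 1
      ext m
      simp only [Finset.mem_range, Finset.mem_filter]
      omega
    rw [hfilter, ← Finset.sum_sub_distrib]
    refine (Finset.abs_sum_le_sum_abs _ _).trans ((Finset.sum_le_sum fun m _ => hbd N m).trans ?_)
    rw [← Finset.mul_sum]
    exact mul_le_mul_of_nonneg_left (hK N M) (by positivity)
  refine squeeze_zero_norm (a := fun N : ℕ => 4 * C * (K / √((N : ℝ) + 1))) (fun N => ?_) ?_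
  · refine le_of_tendsto ((hlim N).sub_const (∑ m ∈ Finset.range N, T m)).norm ?_
    filter_upwards [eventually_ge_atTop N] with M hM
    exact hfin N M hM
  · have : Tendsto (fun N : ℕ => √((N : ℝ) + 1)) atTop atTop :=
      Real.tendsto_sqrt_atTop.comp
        (tendsto_atTop_add_const_right _ _ tendsto_natCast_atTop_atTop)
    simpa using (this.const_div_atTop K).const_mul (4 * C)

/-! ### Reindexing and the sum over the nodes -/

theorem sum_Icc_one_eq_sum_range (f : ℕ → ℝ) (n : ℕ) :
    ∑ j ∈ Finset.Icc 1 n, f j = ∑ j ∈ Finset.range n, f (j + 1) := by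
  induction n with
  | zero => simp
  | succ n ih => rw [Finset.sum_Icc_succ_top (by omega), ih, Finset.sum_range_succ]

theorem sum_Icc_one_eq_sum_range_sub (f : ℕ → ℝ) (n : ℕ) :
    ∑ j ∈ Finset.Icc 1 n, f j = ∑ j ∈ Finset.range n, f (n - j) := by
  rw [sum_Icc_one_eq_sum_range, ← Finset.sum_range_reflect]
  refine Finset.sum_congr rfl fun j hj => ?_
  have := Finset.mem_range.mp hj
  congr 1
  omega

theorem sum_range_mul_eq (f : ℕ → ℝ) (n N : ℕ) :
    ∑ r ∈ Finset.range (n * N), f r =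
      ∑ j ∈ Finset.range n, ∑ t ∈ Finset.range N, f (n * t + j) := by
  rw [Finset.sum_comm]
  induction N with
  | zero => simp
  | succ N ih => rw [mul_add, mul_one, Finset.sum_range_add, ih, Finset.sum_range_succ]

/-- Interchanging the two Lerch terms costs c(-1)ᵏ, whose square is 1; for c = k = 1 this is the
oddness of the cotangent about π/2. -/
theorem lerchTheta_sub {c : ℝ} (hc : c = 1 ∨ c = -1) (k : ℕ) {s r : ℝ} (hr : r ≠ 0) :
    lerchTheta c k (r - s) r = c * (-1) ^ k * lerchTheta c k s r := by
  simp only [lerchTheta]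
  split_ifs with h
  · obtain ⟨rfl, rfl⟩ := h
    rw [show Real.pi * (r - s) / r = Real.pi - Real.pi * s / r by field_simp,
      Real.cot_eq_cos_div_sin, Real.cot_eq_cos_div_sin, Real.cos_pi_sub, Real.sin_pi_sub]
    ring
  · have h1 : ((-1 : ℝ) ^ k) * (-1) ^ k = 1 := by simp [← mul_pow]
    have h2 : c * c = 1 := by rcases hc with rfl | rfl <;> norm_num
    rw [sub_sub_cancel]
    linear_combination (-lerchPhi c k ((r - s) / r)) * ((-1) ^ k * (-1) ^ k * h2 + h1)

theorem oddNode_eq {n j t : ℕ} (hn : 1 ≤ n) :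
    (2 * (j : ℝ) + 1) / (2 * n) + t = oddNode n (n * t + j) := by
  rw [oddNode_add hn, oddNode]
  congr 1
  field_simp

/-- The double series, summed over the integers first and over the nodes afterwards. -/
theorem tendsto_sum_bilateralValue {a b : ℝ} {p q n : ℕ} (hp : 1 ≤ p) (hq : 1 ≤ q)
    (hn : 1 ≤ n) (ha : a = 1 ∨ a = -1) (hb : b = 1 ∨ b = -1) (haq : a = 1 → q ≠ 1)
    (hbp : b = 1 → p ≠ 1) :
    Tendsto (fun N : ℕ => ∑ r ∈ Finset.range (n * N), a ^ r *
      bilateralValue (a ^ n * b) p q (2 * ((r % n : ℕ) : ℝ) + 1) (2 * n) (r / n)) atTop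
      (𝓝 (∑ k ∈ Finset.range (p / 2 + 1), 2 * (((p + q - 2 * k - 1).choose (q - 1) : ℝ) *
          ((n : ℝ) ^ (p + q - 2 * k) * lerchPhi a (p + q - 2 * k) (1 / 2)) *
          (a ^ n * b * lerchPhi (a ^ n * b) (2 * k) 1)) +
        ∑ k ∈ Finset.range q, ((p + k - 1).choose k : ℝ) * ∑ j ∈ Finset.range n,
          a ^ j * lerchTheta (a ^ n * b) (q - k) (2 * j + 1) (2 * n) *
            lerchPhi b (p + k) ((2 * j + 1) / (2 * n)))) := by
  have hnode (r : ℕ) : (2 * ((r % n : ℕ) : ℝ) + 1) / (2 * n) + ((r / n : ℕ) : ℝ) = oddNode n r := by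
    rw [oddNode_eq hn, Nat.div_add_mod]
  have hA := tendsto_finsetSum (Finset.range (p / 2 + 1)) fun k hk => by
    have hk' := Finset.mem_range.mp hk
    exact ((((((tendsto_lerchPhi ha (by omega : 1 ≤ p + q - 2 * k) (by norm_num : (0 : ℝ) < 1 / 2)
      (fun h => by have := haq h; omega)).comp (tendsto_id.const_mul_atTop' hn)).const_mul
      ((n : ℝ) ^ (p + q - 2 * k))).const_mul ((p + q - 2 * k - 1).choose (q - 1) : ℝ)).mul_const
      (a ^ n * b * lerchPhi (a ^ n * b) (2 * k) 1)).const_mul 2)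
  have hB := tendsto_finsetSum (Finset.range q) fun k _ =>
    (tendsto_finsetSum (Finset.range n) fun j _ =>
      (tendsto_lerchPhi hb (by omega : 1 ≤ p + k) (by positivity : (0 : ℝ) < (2 * j + 1) / (2 * n))
        (fun h => by have := hbp h; omega)).const_mul
          (a ^ j * lerchTheta (a ^ n * b) (q - k) (2 * j + 1) (2 * n))).const_mul
      ((p + k - 1).choose k : ℝ)
  refine (hA.add hB).congr fun N => ?_
  simp only [bilateralValue, hnode, mul_add, Finset.sum_add_distrib, Function.comp_apply, id]
  congr 1
  · simp only [Finset.mul_sum, Finset.sum_mul]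
    rw [Finset.sum_comm]
    refine Finset.sum_congr rfl fun r _ => Finset.sum_congr rfl fun k _ => ?_
    rw [inv_oddNode_pow]
    ring
  · simp only [Finset.mul_sum]
    symm
    rw [Finset.sum_comm]
    refine Finset.sum_congr rfl fun k _ => ?_
    rw [sum_range_mul_eq]
    refine Finset.sum_congr rfl fun j hj => Finset.sum_congr rfl fun t _ => ?_
    have hj' := Finset.mem_range.mp hj
    rw [Nat.mul_add_mod, Nat.mod_eq_of_lt hj', Nat.mul_add_div (by omega), Nat.div_eq_of_lt hj',
      add_zero, ← oddNode_eq hn, mul_pow, ← pow_mul, pow_add, add_comm (t : ℝ)]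
    -- With r = nt + j the signs aʳcᵗ collapse to aʲbᵗ, so the sum over t is a Lerch series in b.
    linear_combination (((p + k - 1).choose k : ℝ) * a ^ j * b ^ t *
      lerchTheta (a ^ n * b) (q - k) (2 * j + 1) (2 * n) *
      ((2 * (j : ℝ) + 1) / (2 * n) + t)⁻¹ ^ (p + k)) * pow_mul_self_eq_one_of_eq_or ha (n * t)

/-! ### Summation by parts and the final formula -/

theorem genHarmonic_eq_sum_range (p : ℕ) (b : ℝ) (k : ℕ) :
    genHarmonic p b k = ∑ m ∈ Finset.range k, b ^ m * ((m : ℝ) + 1)⁻¹ ^ p := by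
  rw [genHarmonic, sum_Icc_one_eq_sum_range]
  refine Finset.sum_congr rfl fun m _ => ?_
  rw [Nat.add_sub_cancel, inv_pow, div_eq_mul_inv]
  push_cast
  rfl

/-- Summation by parts for the series in terms of the partial sums over the nodes. -/
theorem sum_genHarmonic_mul_eq {a : ℝ} (p q : ℕ) {n : ℕ} (hn : 1 ≤ n) (b γ : ℝ) (N : ℕ) :
    ∑ k ∈ Finset.Icc 1 N, (a ^ n) ^ k * genHarmonic p b k * ∑ j ∈ Finset.Icc 1 n,
      a ^ (j - 1) / (2 * (n : ℝ) * (k : ℝ) + 2 * (j : ℝ) - 1) ^ q =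
    (2 * (n : ℝ))⁻¹ ^ q * (genHarmonic p b N * (oddNodeSum a q n (N + 1) - γ) +
      ∑ m ∈ Finset.range N, b ^ m * ((m : ℝ) + 1)⁻¹ ^ p * (γ - oddNodeSum a q n (m + 1))) := by
  -- The k-th inner block is an increment of g, since 2nk + 2j - 1 is 2n times a node.
  have hterm (k : ℕ) : (a ^ n) ^ k * ∑ j ∈ Finset.Icc 1 n,
      a ^ (j - 1) / (2 * (n : ℝ) * (k : ℝ) + 2 * (j : ℝ) - 1) ^ q =
      (2 * (n : ℝ))⁻¹ ^ q * (oddNodeSum a q n (k + 1) - oddNodeSum a q n k) := by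
    rw [oddNodeSum_add_sub hn, mul_one, sum_Icc_one_eq_sum_range, Finset.mul_sum, Finset.mul_sum]
    refine Finset.sum_congr rfl fun j _ => ?_
    have : 2 * (n : ℝ) * k + 2 * ((j + 1 : ℕ) : ℝ) - 1 = 2 * n * (oddNode n j + k) := by
      rw [oddNode]
      push_cast
      field_simp
      ring
    rw [this, Nat.add_sub_cancel, pow_add, ← pow_mul, div_eq_mul_inv, mul_pow, mul_inv, inv_pow,
      inv_pow]
    ring
  induction N with
  | zero => simp [genHarmonic]
  | succ N ih =>
    rw [Finset.sum_Icc_succ_top (by omega), ih, mul_right_comm, hterm, Finset.sum_range_succ]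
    have : genHarmonic p b (N + 1) = genHarmonic p b N + b ^ N * ((N : ℝ) + 1)⁻¹ ^ p := by
      rw [genHarmonic_eq_sum_range, genHarmonic_eq_sum_range, Finset.sum_range_succ]
    rw [this]
    ring

theorem theorem8 (p q n : ℕ) (hp : 1 ≤ p) (hq : 1 ≤ q) (hn : 1 ≤ n) (a b : ℝ)
    (ha : a = (-1) ^ (p + q - 1)) (hb : b = 1 ∨ b = -1)
    (hpb : b = 1 → p ≠ 1) (hqa : a = 1 → q ≠ 1) :
    Tendsto
      (fun N : ℕ => ∑ k ∈ Finset.Icc 1 N,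
        (a ^ n) ^ k * genHarmonic p b k *
          ∑ j ∈ Finset.Icc 1 n,
            a ^ (j - 1) / (2 * (n : ℝ) * (k : ℝ) + 2 * (j : ℝ) - 1) ^ q)
      atTop
      (𝓝
        ((2 : ℝ) ^ (-(q : ℤ) - 1) * (1 - (-1) ^ p) * lerchPhi a q (1 / 2) * lerchPhi b p 1
          - a ^ (n - 1) * (-2 : ℝ) ^ (-(q : ℤ)) * (n : ℝ) ^ p *
              ∑ k ∈ Finset.range (p / 2 + 1),
                ((p + q - 2 * k - 1).choose (q - 1) : ℝ) * (n : ℝ) ^ (-(2 * (k : ℤ))) *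
                  lerchPhi (a ^ n * b) (2 * k) 1 * lerchPhi a (p + q - 2 * k) (1 / 2)
          - 1 / 2 * a * (-2 * (n : ℝ)) ^ (-(q : ℤ)) *
              ∑ j ∈ Finset.Icc 1 n, ∑ k ∈ Finset.Icc 1 q,
                ((p + q - k - 1).choose (p - 1) : ℝ) * a ^ j * (-1) ^ k *
                  lerchTheta (a ^ n * b) k (2 * (j : ℝ) - 1) (2 * (n : ℝ)) *
                  lerchPhi b (p + q - k)
                    ((2 * (n : ℝ) - 2 * (j : ℝ) + 1) / (2 * (n : ℝ))))) := by
  have ha' : a = 1 ∨ a = -1 := ha ▸ neg_one_pow_eq_or ℝ _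
  have hc : a ^ n * b = 1 ∨ a ^ n * b = -1 := by
    rcases ha' with rfl | rfl <;> rcases hb with rfl | rfl <;>
      rcases neg_one_pow_eq_or ℝ n with h | h <;> simp [h]
  have hpp : (-1 : ℝ) ^ p * (-1) ^ p = 1 := pow_mul_self_eq_one_of_eq_or (Or.inr rfl) p
  have hqq : (-1 : ℝ) ^ q * (-1) ^ q = 1 := pow_mul_self_eq_one_of_eq_or (Or.inr rfl) q
  have haa : a * a = 1 := by simpa using pow_mul_self_eq_one_of_eq_or ha' 1
  have hbb : b * b = 1 := by simpa using pow_mul_self_eq_one_of_eq_or hb 1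
  -- This is the parity condition on a, and it makes the g(m) contributions of m and -m reinforce
  -- each other instead of cancelling.
  have hpq : (-1) ^ q * a = -(-1) ^ p := by
    have : (-1 : ℝ) ^ (p + q) = -a := by
      rw [ha, ← Nat.sub_add_cancel (by omega : 1 ≤ p + q), pow_succ, Nat.add_sub_cancel]
      ring
    rw [pow_add] at this
    linear_combination (-1) ^ q * this - (-1) ^ p * hqq
  have hn0 : (n : ℝ) ≠ 0 := by positivity
  set γ := (n : ℝ) ^ q * lerchPhi a q (1 / 2) with hγ
  have hF := tendsto_sum_bilateralValue hp hq hn ha' hb hqa hpb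
  have hD := tendsto_sum_bilateral_sub_sum_oddNodeSum hp hq hn ha' hb hqa hpq
    (ℓ := fun r => bilateralValue (a ^ n * b) p q (2 * ((r % n : ℕ) : ℝ) + 1) (2 * n) (r / n))
    fun r => by
      have hlt : 2 * ((r % n : ℕ) : ℝ) + 1 < 2 * n := by
        have : 2 * (r % n) + 1 < 2 * n := by have := Nat.mod_lt r hn; omega
        exact_mod_cast this
      have h := tendsto_bilateralValue hc hp hq (by positivity) hlt (r / n)
      rwa [oddNode_eq hn, Nat.div_add_mod] at h
  have hH : Tendsto (genHarmonic p b) atTop (𝓝 (lerchPhi b p 1)) := by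
    simpa only [← genHarmonic_eq_sum_range] using tendsto_lerchPhi hb hp one_pos hpb
  have hg : Tendsto (fun N => oddNodeSum a q n (N + 1) - γ) atTop (𝓝 0) := by
    obtain ⟨C, -, hC⟩ := exists_abs_oddNodeSum_sub_le ha' hq hn hqa
    refine squeeze_zero_norm (fun N => hC (N + 1)) ?_
    exact (tendsto_atTop_add_const_right _ _ tendsto_natCast_atTop_atTop).const_div_atTop C
      |>.comp (tendsto_add_atTop_nat 1)
  have hQ := hF.sub hD
  simp only [sub_sub_cancel, sub_zero] at hQ
  simp only [sum_genHarmonic_mul_eq p q hn b γ]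
  -- The boundary term vanishes; the exchanged double series is solved for the wanted sum by
  -- dividing by 2(-1)ᵖ. The factor b turns bᵐ⁺¹ into bᵐ.
  have hlim := ((hH.mul hg).add (((hQ.const_mul b).sub
    (hH.const_mul ((1 - (-1) ^ p) * γ))).const_mul ((-1) ^ p / 2))).const_mul
    ((2 * (n : ℝ))⁻¹ ^ q)
  convert hlim using 1
  · funext N
    congr 2
    have : b * ∑ m ∈ Finset.range N, b ^ (m + 1) * ((m : ℝ) + 1)⁻¹ ^ p *
        (2 * (-1) ^ p * (γ - oddNodeSum a q n (m + 1)) + (1 - (-1) ^ p) * γ) =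
        2 * (-1) ^ p * ∑ m ∈ Finset.range N, b ^ m * ((m : ℝ) + 1)⁻¹ ^ p *
          (γ - oddNodeSum a q n (m + 1)) + (1 - (-1) ^ p) * γ * genHarmonic p b N := by
      rw [genHarmonic_eq_sum_range, Finset.mul_sum, Finset.mul_sum, Finset.mul_sum,
        ← Finset.sum_add_distrib]
      refine Finset.sum_congr rfl fun m _ => ?_
      linear_combination (b ^ m * ((m : ℝ) + 1)⁻¹ ^ p *
        (2 * (-1) ^ p * (γ - oddNodeSum a q n (m + 1)) + (1 - (-1) ^ p) * γ)) * hbb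
    rw [this, add_sub_cancel_right]
    linear_combination (-∑ m ∈ Finset.range N, b ^ m * ((m : ℝ) + 1)⁻¹ ^ p *
      (γ - oddNodeSum a q n (m + 1))) * hpp
  · congr 1
    have hz1 : (2 : ℝ) ^ (-(q : ℤ) - 1) = 2⁻¹ ^ q / 2 := by
      rw [zpow_sub₀ two_ne_zero, zpow_neg, zpow_natCast, zpow_one, inv_pow]
    have hz2 : (-2 : ℝ) ^ (-(q : ℤ)) = (-1) ^ q * 2⁻¹ ^ q := by
      rw [zpow_neg, zpow_natCast, ← inv_pow, ← mul_pow]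
      norm_num
    have hz3 : (-2 * (n : ℝ)) ^ (-(q : ℤ)) = (-1) ^ q * (2 * (n : ℝ))⁻¹ ^ q := by
      rw [zpow_neg, zpow_natCast, ← inv_pow, ← mul_pow, neg_mul, inv_neg, neg_one_mul]
    have hn2 : (2 * (n : ℝ))⁻¹ ^ q * (n : ℝ) ^ q = 2⁻¹ ^ q := by
      rw [← mul_pow]
      congr 1
      field_simp
    have han : a ^ (n - 1) = a * a ^ n := by
      obtain ⟨d, rfl⟩ := Nat.exists_eq_add_of_le' hn
      rw [Nat.add_sub_cancel, pow_succ]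
      linear_combination (-a ^ d) * haa
    have hE : a ^ (n - 1) * (-2 : ℝ) ^ (-(q : ℤ)) * (n : ℝ) ^ p *
        ∑ k ∈ Finset.range (p / 2 + 1),
          ((p + q - 2 * k - 1).choose (q - 1) : ℝ) * (n : ℝ) ^ (-(2 * (k : ℤ))) *
            lerchPhi (a ^ n * b) (2 * k) 1 * lerchPhi a (p + q - 2 * k) (1 / 2) =
        -((2 * (n : ℝ))⁻¹ ^ q * ((-1) ^ p / 2) * b *
          ∑ k ∈ Finset.range (p / 2 + 1), 2 * (((p + q - 2 * k - 1).choose (q - 1) : ℝ) *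
            ((n : ℝ) ^ (p + q - 2 * k) * lerchPhi a (p + q - 2 * k) (1 / 2)) *
            (a ^ n * b * lerchPhi (a ^ n * b) (2 * k) 1))) := by
      rw [← mul_neg, ← Finset.sum_neg_distrib, Finset.mul_sum, Finset.mul_sum, han, hz2]
      refine Finset.sum_congr rfl fun k hk => ?_
      have hk' := Finset.mem_range.mp hk
      have hpow : (n : ℝ) ^ (p + q - 2 * k) = n ^ p * n ^ q * (n : ℝ) ^ (-(2 * (k : ℤ))) := by
        rw [← pow_add, ← zpow_natCast, ← zpow_natCast, ← zpow_add₀ hn0]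
        congr 1
        omega
      rw [hpow, ← hn2]
      generalize (n : ℝ) ^ (-(2 * (k : ℤ))) = u
      generalize lerchPhi (a ^ n * b) (2 * k) 1 = v
      generalize lerchPhi a (p + q - 2 * k) (1 / 2) = w
      generalize ((p + q - 2 * k - 1).choose (q - 1) : ℝ) = x
      linear_combination (a ^ n * ((2 * (n : ℝ))⁻¹ ^ q * (n : ℝ) ^ q) * n ^ p * (x * u * v * w)) *
        (hpq + (-1) ^ p * hbb)
    have hT : 1 / 2 * a * (-2 * (n : ℝ)) ^ (-(q : ℤ)) *
        ∑ j ∈ Finset.Icc 1 n, ∑ k ∈ Finset.Icc 1 q,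
          ((p + q - k - 1).choose (p - 1) : ℝ) * a ^ j * (-1) ^ k *
            lerchTheta (a ^ n * b) k (2 * (j : ℝ) - 1) (2 * (n : ℝ)) *
            lerchPhi b (p + q - k) ((2 * (n : ℝ) - 2 * (j : ℝ) + 1) / (2 * (n : ℝ))) =
        -((2 * (n : ℝ))⁻¹ ^ q * ((-1) ^ p / 2) * b *
          ∑ k ∈ Finset.range q, ((p + k - 1).choose k : ℝ) * ∑ j ∈ Finset.range n,
            a ^ j * lerchTheta (a ^ n * b) (q - k) (2 * j + 1) (2 * n) *
              lerchPhi b (p + k) ((2 * j + 1) / (2 * n))) := by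
      -- Reversing both indices, j to n - j and k to q - k, sends 2j - 1 to 2n - (2j + 1), which
      -- `lerchTheta_sub` then reflects.
      simp only [sum_Icc_one_eq_sum_range_sub]
      rw [Finset.sum_comm, hz3, ← mul_neg, ← Finset.sum_neg_distrib, Finset.mul_sum,
        Finset.mul_sum]
      refine Finset.sum_congr rfl fun k hk => ?_
      have hk' := Finset.mem_range.mp hk
      rw [← mul_neg, ← Finset.sum_neg_distrib, Finset.mul_sum, Finset.mul_sum, Finset.mul_sum]
      refine Finset.sum_congr rfl fun j hj => ?_
      have hj' := Finset.mem_range.mp hj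
      have hcast : ((n - j : ℕ) : ℝ) = n - j := Nat.cast_sub hj'.le
      have hchoose : (p + q - (q - k) - 1).choose (p - 1) = (p + k - 1).choose k := by
        rw [show p + q - (q - k) - 1 = p + k - 1 by omega]
        exact Nat.choose_symm_of_eq_add (by omega)
      have haj : a ^ (n - j) = a ^ n * a ^ j := by
        rw [← Nat.sub_add_cancel hj'.le, pow_add, Nat.sub_add_cancel hj'.le]
        linear_combination (-a ^ (n - j)) * pow_mul_self_eq_one_of_eq_or ha' j
      rw [hcast, hchoose, haj, show p + q - (q - k) = p + k by omega,
        show 2 * ((n : ℝ) - j) - 1 = 2 * n - (2 * j + 1) by ring,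
        show 2 * (n : ℝ) - 2 * (n - j) + 1 = 2 * j + 1 by ring,
        lerchTheta_sub hc _ (by positivity)]
      generalize lerchTheta (a ^ n * b) (q - k) (2 * j + 1) (2 * n) = v
      generalize lerchPhi b (p + k) ((2 * j + 1) / (2 * n)) = w
      generalize ((p + k - 1).choose k : ℝ) = x
      have h1 := pow_mul_self_eq_one_of_eq_or ha' n
      have h2 := pow_mul_self_eq_one_of_eq_or (Or.inr rfl : (-1 : ℝ) = 1 ∨ (-1 : ℝ) = -1) (q - k)
      linear_combination (1 / 2 * (2 * (n : ℝ))⁻¹ ^ q * x * a ^ j * v * w * b) *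
        (hpq + (-1) ^ q * a * ((-1) ^ (q - k) * (-1) ^ (q - k) * h1 + h2))
    rw [hE, hT, hz1, hγ, ← hn2]
    -- What remains is -(-1)ᵖ(1 - (-1)ᵖ) = 1 - (-1)ᵖ.
    linear_combination ((2 * (n : ℝ))⁻¹ ^ q * (n : ℝ) ^ q / 2 * lerchPhi a q (1 / 2) *
      lerchPhi b p 1) * (-hpp)
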